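/- **Setting.** Let $\mathbf P$ be a set of propositions. A timed word over $2^{\mathbf P}$ is a finite non-empty or infinite sequence $\rho=(\sigma,\tau)$ of events $(\sigma_i,\tau_i)$ with $\sigma_i\subseteq\mathbf P$, $\tau_0=0$ and $\tau$ strictly increasing; if $\rho$ is infinite, $\tau$ is unbounded. $\mathsf{MTL}[\mathfrak U,\mathfrak S]$ formulas are given by $$\varphi::=\mathbf{true}\mid P\mid\varphi_1\wedge\varphi_2\mid\neg\varphi\mid\varphi_1\,\mathcal U_I\,\varphi_2\mid\varphi_1\,\mathcal S_I\,\varphi_2\mid\varphi_1\,\mathfrak U^c_I\,\varphi_2\mid\varphi_1\,\mathfrak S^c_I\,\varphi_2,$$ where $I\subseteq(0,\infty)$ is a non-empty interval with endpoints in $\mathbb Q_{\ge0}\cup\{\infty\}$ and $c\in\mathbb Q$, $0\le c\le a:=\inf I$. The formula is *bounded* if all its intervals are bounded. *Semantics.* For a position $i$ of a (finite or infinite) timed word, $\rho,i\models\varphi$ is defined as usual for $\mathbf{true},P,\wedge,\neg$, and: $\rho,i\models\varphi_1\,\mathcal U_I\,\varphi_2$ iff there is a position $j>i$ with $\rho,j\models\varphi_2$,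 $\tau_j-\tau_i\in I$ and $\rho,k\models\varphi_1$ for all $i<k<j$; $\mathfrak U^c_I$ is the same except that $\varphi_1$ is only required at those $k$, $i<k<j$, with $\tau_k-\tau_i>c$ and $\tau_j-\tau_k>a-c$; $\mathcal S_I,\mathfrak S^c_I$ are the mirror images (with $j<i$). For finite $\rho$ the strong relation $\models_f^+$ and the weak relation $\models_f^-$ are defined by the same clauses (each relation being used for its own subformulas), except that $\rho,i\models_f^{\pm}\neg\varphi$ iff not $\rho,i\models_f^{\mp}\varphi$, and that $\rho,i\models_f^-\varphi_1\,\mathcal U_I\,\varphi_2$ (resp. $\varphi_1\,\mathfrak U_I^c\,\varphi_2$) also holds if $\tau_{|\rho|-1}-\tau_i<\sup I$ and $\rho,k\models_f^-\varphi_1$ for all $k$ with $i<k<|\rho|$ (resp. for those of them with $\tau_k-\tau_i>c$ and $\tau_{|\rho|-1}-\tau_k\ge a-c$). A finite $\rho$ is an *informative good prefix* for $\varphi$ if $\rho,0\models_f^+\varphi$, and an *informative bad prefix* if not $\rho,0\models_f^-\varphi$. *Reach.* Future-reach and past-reach are defined by: $\mathrm{fr}=\mathrm{pr}=0$ for $\mathbf{true}$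 and $P$; the maximum over the immediate subformulas for $\wedge,\neg$; $\mathrm{fr}(\varphi_1\mathcal U_I\varphi_2)=\sup I+\max(\mathrm{fr}\,\varphi_1,\mathrm{fr}\,\varphi_2)$; $\mathrm{fr}(\varphi_1\mathcal S_I\varphi_2)=\max(\mathrm{fr}\,\varphi_1,\mathrm{fr}\,\varphi_2-\inf I)$; $\mathrm{fr}(\varphi_1\mathfrak U^c_I\varphi_2)=\max(c+\sup I-\inf I+\mathrm{fr}\,\varphi_1,\ \sup I+\mathrm{fr}\,\varphi_2)$; $\mathrm{fr}(\varphi_1\mathfrak S^c_I\varphi_2)=\max(0,\ \mathrm{fr}\,\varphi_1-c,\ \mathrm{fr}\,\varphi_2-\inf I)$; and $\mathrm{pr}$ by the same equations with $\mathcal U,\mathcal S$ and $\mathfrak U,\mathfrak S$ exchanged. **The monitor.** Let $\hat\varphi=\Phi(\psi_1,\dots,\psi_m)$, where $\psi_1,\dots,\psi_m$ are bounded $\mathsf{MTL}[\mathfrak U,\mathfrak S]$ formulas and $\Phi$ is an $\mathsf{LTL}$ formula (built from $\mathbf{true}$, propositions, $\wedge,\neg,\mathcal U_{(0,\infty)},\mathcal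 S_{(0,\infty)}$) over new propositions $Q_1,\dots,Q_m$, for which the $\psi_i$ are substituted. Let $\mathcal A_\Phi$ be the two-way alternating Büchi automaton over $\Sigma_Q=2^{\{Q_1,\dots,Q_m\}}$ obtained from $\Phi$ by the standard translation; let $\mathcal D_{\mathrm{good}}$ be the deterministic finite automaton obtained by emptying the accepting set of $\mathcal A_\Phi$, reading it as an automaton over finite words, and determinising it; and let $\mathcal D_{\mathrm{bad}}$ be obtained in the same way from $\neg\Phi$. The input is an infinite timed word $\rho$ of variability at most $k$, i.e. with at most $k$ events in any open unit interval of time. Put $l_{\mathrm{fr}}=\max_i k\lceil\mathrm{fr}(\psi_i)\rceil$ and $l_{\mathrm{pr}}=\max_i k\lceil\mathrm{pr}(\psi_i)\rceil$. For $j=0,1,2,\dots$ the monitor evaluates $\psi_1,\dots,\psi_m$ at position $j$ on the finite window consisting of the events of $\rho$ at positions $\max(0,j-l_{\mathrm{pr}}),\dots,j+l_{\mathrm{fr}}$, and feeds the letter $u_j\in\Sigma_Q$ of those $Q_i$ for which $\psi_i$ was found to hold there (in the sense of $\models$) into $\mathcal D_{\mathrm{good}}$ and $\mathcal D_{\mathrm{bad}}$.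 **Theorem (Soundness).** The letters are the truth values of the bounded subformulas on the input: $Q_i\in u_j\iff\rho,j\models\psi_i$ for all $i$ and $j$. Moreover, if $\mathcal D_{\mathrm{good}}$ (resp. $\mathcal D_{\mathrm{bad}}$) is in an accepting state after reading some finite word $u_0\cdots u_{l-1}$, then an informative good (resp. bad) prefix for $\hat\varphi$ is eventually read: all sufficiently long finite prefixes of $\rho$ are informative good (resp. bad) prefixes for $\hat\varphi$. -/

import Mathlib

/-! ## Time intervals, formulas and timed words -/

/-- A non-empty interval `I ⊆ (0, ∞)` with left endpoint `lo = inf I` in `ℚ≥0` and right endpoint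
`hi = sup I` in `ℚ≥0 ∪ {∞}`; the two flags say which endpoints belong to `I`
(`hiClosed` is irrelevant when `hi = ∞`). -/
structure TimeInterval where
  lo : NNRat
  hi : WithTop NNRat
  loClosed : Bool
  hiClosed : Bool
  pos : loClosed = true → 0 < lo
  nonempty : (lo : WithTop NNRat) < hi ∨
    ((lo : WithTop NNRat) = hi ∧ loClosed = true ∧ hiClosed = true)

namespace TimeInterval

/-- The set of reals described by the interval. -/
def toSet (I : TimeInterval) : Set ℝ :=
  {x | (if I.loClosed then (I.lo : ℝ) ≤ x else (I.lo : ℝ) < x) ∧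
    ∀ b : NNRat, I.hi = (b : WithTop NNRat) → if I.hiClosed then x ≤ (b : ℝ) else x < (b : ℝ)}

/-- `x < sup I`, where `sup I` may be `∞`. -/
def LtSup (I : TimeInterval) (x : ℝ) : Prop :=
  ∀ b : NNRat, I.hi = (b : WithTop NNRat) → x < (b : ℝ)

/-- `I` is bounded, i.e. `sup I < ∞`. -/
def IsBounded (I : TimeInterval) : Prop := I.hi ≠ ⊤

/-- `sup I` for a bounded interval `I` (the value `0` for unbounded `I` is never used). -/
def sup (I : TimeInterval) : NNRat := I.hi.untopD 0

/-- The interval `(0, ∞)`. -/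
def univ : TimeInterval where
  lo := 0
  hi := ⊤
  loClosed := false
  hiClosed := false
  pos := by simp
  nonempty := Or.inl (WithTop.coe_lt_top _)

end TimeInterval

/-- Formulas of metric temporal logic with until, since, generalised until `𝔘^c_I` and
generalised since `𝔖^c_I` (the latter two with `0 ≤ c ≤ inf I`), over monadic predicates `P`. -/
inductive MTL (P : Type*) where
  | tt : MTL P
  | atom (p : P) : MTL P
  | and (φ₁ φ₂ : MTL P) : MTL P
  | neg (φ : MTL P) : MTL P
  | untl (I : TimeInterval) (φ₁ φ₂ : MTL P) : MTL P
  | snce (I : TimeInterval) (φ₁ φ₂ : MTL P) : MTL P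
  | guntl (I : TimeInterval) (c : NNRat) (hc : c ≤ I.lo) (φ₁ φ₂ : MTL P) : MTL P
  | gsnce (I : TimeInterval) (c : NNRat) (hc : c ≤ I.lo) (φ₁ φ₂ : MTL P) : MTL P

/-- Infinite timed words over the alphabet `2^P`: the first timestamp is `0`, timestamps are
strictly increasing and unbounded (non-Zeno). -/
structure InfTimedWord (P : Type*) where
  σ : ℕ → Set P
  τ : ℕ → ℝ
  init : τ 0 = 0
  mono : StrictMono τ
  unbounded : ∀ x : ℝ, ∃ n, x < τ n

/-- Finite (non-empty) timed words over the alphabet `2^P`, with `last + 1` events at the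
positions `0, …, last`. -/
structure FinTimedWord (P : Type*) where
  last : ℕ
  σ : Fin (last + 1) → Set P
  τ : Fin (last + 1) → ℝ
  init : τ 0 = 0
  mono : StrictMono τ

/-- There are at most `k` events in any open unit time interval. -/
def InfTimedWord.VariabilityAtMost {P : Type*} (ρ : InfTimedWord P) (k : ℕ) : Prop :=
  ∀ t : ℝ, 0 ≤ t → {i : ℕ | ρ.τ i ∈ Set.Ioo t (t + 1)}.encard ≤ k

/-- The finite timed word formed by the events of `ρ` at positions `s, s + 1, …, s + l`, with
time shifted so that the first of them has timestamp `0`. -/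
def InfTimedWord.window {P : Type*} (ρ : InfTimedWord P) (s l : ℕ) : FinTimedWord P where
  last := l
  σ k := ρ.σ (s + k)
  τ k := ρ.τ (s + k) - ρ.τ s
  init := by simp
  mono := fun a b h => by
    have : ρ.τ (s + a) < ρ.τ (s + b) := ρ.mono (by simpa using h)
    simpa using this

/-- The prefix of `ρ` consisting of its first `n + 1` events. -/
def InfTimedWord.pre {P : Type*} (ρ : InfTimedWord P) (n : ℕ) : FinTimedWord P where
  last := n
  σ k := ρ.σ k
  τ k := ρ.τ k
  init := by simpa using ρ.init
  mono := fun a b h => ρ.mono (by simpa using h)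

/-! ## Semantics -/

namespace MTL

variable {P : Type*}

/-- The pointwise semantics on a sequence of events `(σ, τ)` indexed by a linear order `X` of
positions. With `X = ℕ` it is the relation `ρ, i ⊨ φ` for infinite timed words, and with `X` an
initial segment of `ℕ` it is the neutral relation `ρ, i ⊨_f φ` for finite timed words. -/
def PSat {X : Type*} [LinearOrder X] (σ : X → Set P) (τ : X → ℝ) : MTL P → X → Prop
  | tt, _ => True
  | atom p, i => p ∈ σ i
  | and φ₁ φ₂, i => PSat σ τ φ₁ i ∧ PSat σ τ φ₂ i
  | neg φ, i => ¬ PSat σ τ φ i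
  | untl I φ₁ φ₂, i => ∃ j, i < j ∧ PSat σ τ φ₂ j ∧ τ j - τ i ∈ I.toSet ∧
      ∀ k, i < k → k < j → PSat σ τ φ₁ k
  | snce I φ₁ φ₂, i => ∃ j, j < i ∧ PSat σ τ φ₂ j ∧ τ i - τ j ∈ I.toSet ∧
      ∀ k, j < k → k < i → PSat σ τ φ₁ k
  | guntl I c _ φ₁ φ₂, i => ∃ j, i < j ∧ PSat σ τ φ₂ j ∧ τ j - τ i ∈ I.toSet ∧
      ∀ k, i < k → k < j → (c : ℝ) < τ k - τ i → (I.lo : ℝ) - c < τ j - τ k → PSat σ τ φ₁ k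
  | gsnce I c _ φ₁ φ₂, i => ∃ j, j < i ∧ PSat σ τ φ₂ j ∧ τ i - τ j ∈ I.toSet ∧
      ∀ k, j < k → k < i → (c : ℝ) < τ i - τ k → (I.lo : ℝ) - c < τ k - τ j → PSat σ τ φ₁ k

end MTL

/-- `ρ, i ⊨ φ` for an infinite timed word `ρ`. -/
def InfTimedWord.Sat {P : Type*} (ρ : InfTimedWord P) (i : ℕ) (φ : MTL P) : Prop :=
  φ.PSat ρ.σ ρ.τ i

/-- The neutral relation `ρ, i ⊨_f φ` for a finite timed word `ρ`. -/
def FinTimedWord.Sat {P : Type*} (ρ : FinTimedWord P) (i : Fin (ρ.last + 1)) (φ : MTL P) : Prop :=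
  φ.PSat ρ.σ ρ.τ i

/-- The two non-neutral views on satisfaction over finite timed words. -/
inductive View where
  | strong
  | weak

/-- The opposite view. -/
def View.flip : View → View
  | strong => weak
  | weak => strong

/-- The truncated semantics: `TSat ρ strong φ i` is `ρ, i ⊨_f⁺ φ` and
`TSat ρ weak φ i` is `ρ, i ⊨_f⁻ φ`. The clauses agree for the two views, except that negation
exchanges the views and that (generalised) until has an additional alternative in the weak view. -/
def FinTimedWord.TSat {P : Type*} (ρ : FinTimedWord P) :
    View → MTL P → Fin (ρ.last + 1) → Prop
  | _, .tt, _ => True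
  | _, .atom p, i => p ∈ ρ.σ i
  | v, .and φ₁ φ₂, i => TSat ρ v φ₁ i ∧ TSat ρ v φ₂ i
  | v, .neg φ, i => ¬ TSat ρ v.flip φ i
  | v, .untl I φ₁ φ₂, i =>
      (∃ j, i < j ∧ TSat ρ v φ₂ j ∧ ρ.τ j - ρ.τ i ∈ I.toSet ∧
        ∀ k, i < k → k < j → TSat ρ v φ₁ k) ∨
      (v = View.weak ∧ I.LtSup (ρ.τ (Fin.last _) - ρ.τ i) ∧ ∀ k, i < k → TSat ρ v φ₁ k)
  | v, .snce I φ₁ φ₂, i =>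
      ∃ j, j < i ∧ TSat ρ v φ₂ j ∧ ρ.τ i - ρ.τ j ∈ I.toSet ∧
        ∀ k, j < k → k < i → TSat ρ v φ₁ k
  | v, .guntl I c _ φ₁ φ₂, i =>
      (∃ j, i < j ∧ TSat ρ v φ₂ j ∧ ρ.τ j - ρ.τ i ∈ I.toSet ∧
        ∀ k, i < k → k < j → (c : ℝ) < ρ.τ k - ρ.τ i → (I.lo : ℝ) - c < ρ.τ j - ρ.τ k →
          TSat ρ v φ₁ k) ∨
      (v = View.weak ∧ I.LtSup (ρ.τ (Fin.last _) - ρ.τ i) ∧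
        ∀ k, i < k → (c : ℝ) < ρ.τ k - ρ.τ i →
          (I.lo : ℝ) - c ≤ ρ.τ (Fin.last _) - ρ.τ k → TSat ρ v φ₁ k)
  | v, .gsnce I c _ φ₁ φ₂, i =>
      ∃ j, j < i ∧ TSat ρ v φ₂ j ∧ ρ.τ i - ρ.τ j ∈ I.toSet ∧
        ∀ k, j < k → k < i → (c : ℝ) < ρ.τ i - ρ.τ k → (I.lo : ℝ) - c < ρ.τ k - ρ.τ j →
          TSat ρ v φ₁ k

/-- `ρ` is an informative good prefix for `φ`: `ρ, 0 ⊨_f⁺ φ`. -/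
def FinTimedWord.InformativeGood {P : Type*} (ρ : FinTimedWord P) (φ : MTL P) : Prop :=
  ρ.TSat View.strong φ 0

/-- `ρ` is an informative bad prefix for `φ`: not `ρ, 0 ⊨_f⁻ φ`. -/
def FinTimedWord.InformativeBad {P : Type*} (ρ : FinTimedWord P) (φ : MTL P) : Prop :=
  ¬ ρ.TSat View.weak φ 0

/-! ## Bounded formulas, past and future reach -/

namespace MTL

variable {P : Type*}

/-- All intervals constraining temporal operators of the formula are bounded. -/
def Bounded : MTL P → Prop
  | tt => True
  | atom _ => True
  | and φ₁ φ₂ => Bounded φ₁ ∧ Bounded φ₂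
  | neg φ => Bounded φ
  | untl I φ₁ φ₂ => I.IsBounded ∧ Bounded φ₁ ∧ Bounded φ₂
  | snce I φ₁ φ₂ => I.IsBounded ∧ Bounded φ₁ ∧ Bounded φ₂
  | guntl I _ _ φ₁ φ₂ => I.IsBounded ∧ Bounded φ₁ ∧ Bounded φ₂
  | gsnce I _ _ φ₁ φ₂ => I.IsBounded ∧ Bounded φ₁ ∧ Bounded φ₂

/-- Future-reach. Reaches are lengths of time, so subtraction is truncated at `0`: the evaluation
at a position always involves the event at that position itself. -/
def fr : MTL P → NNRat
  | tt => 0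
  | atom _ => 0
  | and φ₁ φ₂ => max (fr φ₁) (fr φ₂)
  | neg φ => fr φ
  | untl I φ₁ φ₂ => I.sup + max (fr φ₁) (fr φ₂)
  | snce I φ₁ φ₂ => max (fr φ₁) (fr φ₂ - I.lo)
  | guntl I c _ φ₁ φ₂ => max (c + (I.sup - I.lo) + fr φ₁) (I.sup + fr φ₂)
  | gsnce I c _ φ₁ φ₂ => max (fr φ₁ - c) (fr φ₂ - I.lo)

/-- Past-reach (see `fr`). -/
def pr : MTL P → NNRat
  | tt => 0
  | atom _ => 0
  | and φ₁ φ₂ => max (pr φ₁) (pr φ₂)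
  | neg φ => pr φ
  | untl I φ₁ φ₂ => max (pr φ₁) (pr φ₂ - I.lo)
  | snce I φ₁ φ₂ => I.sup + max (pr φ₁) (pr φ₂)
  | guntl I c _ φ₁ φ₂ => max (pr φ₁ - c) (pr φ₂ - I.lo)
  | gsnce I c _ φ₁ φ₂ => max (c + (I.sup - I.lo) + pr φ₁) (I.sup + pr φ₂)

end MTL

/-! ## LTL over the propositions `Q₁, …, Q_m` -/

/-- LTL formulas (with strict until and since) over propositions `Q₁, …, Q_m`. -/
inductive LTL (m : ℕ) where
  | tt : LTL m
  | atom (q : Fin m) : LTL m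
  | and (Φ₁ Φ₂ : LTL m) : LTL m
  | neg (Φ : LTL m) : LTL m
  | untl (Φ₁ Φ₂ : LTL m) : LTL m
  | snce (Φ₁ Φ₂ : LTL m) : LTL m

namespace LTL

variable {m : ℕ}

/-- The formula `Φ(ψ₁, …, ψ_m)`; the LTL operators are the temporal operators with the
interval `(0, ∞)`. -/
def subst {P : Type*} (ψ : Fin m → MTL P) : LTL m → MTL P
  | tt => .tt
  | atom q => ψ q
  | and Φ₁ Φ₂ => .and (subst ψ Φ₁) (subst ψ Φ₂)
  | neg Φ => .neg (subst ψ Φ)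
  | untl Φ₁ Φ₂ => .untl TimeInterval.univ (subst ψ Φ₁) (subst ψ Φ₂)
  | snce Φ₁ Φ₂ => .snce TimeInterval.univ (subst ψ Φ₁) (subst ψ Φ₂)

/-- The set of subformulas. -/
def sub : LTL m → Set (LTL m)
  | tt => {tt}
  | atom q => {atom q}
  | and Φ₁ Φ₂ => {and Φ₁ Φ₂} ∪ (sub Φ₁ ∪ sub Φ₂)
  | neg Φ => {neg Φ} ∪ sub Φ
  | untl Φ₁ Φ₂ => {untl Φ₁ Φ₂} ∪ (sub Φ₁ ∪ sub Φ₂)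
  | snce Φ₁ Φ₂ => {snce Φ₁ Φ₂} ∪ (sub Φ₁ ∪ sub Φ₂)

theorem mem_sub_self (Φ : LTL m) : Φ ∈ sub Φ := by
  cases Φ <;> simp [sub]

theorem sub_trans {Φ Ψ : LTL m} (h : Ψ ∈ sub Φ) : sub Ψ ⊆ sub Φ := by
  induction Φ with
  | tt | atom => simp only [sub, Set.mem_singleton_iff] at h; subst h; exact subset_rfl
  | neg a iha =>
    simp only [sub, Set.mem_union, Set.mem_singleton_iff] at h
    rcases h with rfl | h
    · exact subset_rfl
    · exact (iha h).trans Set.subset_union_right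
  | and a b iha ihb | untl a b iha ihb | snce a b iha ihb =>
    simp only [sub, Set.mem_union, Set.mem_singleton_iff] at h
    rcases h with rfl | h | h
    · exact subset_rfl
    · exact (iha h).trans (Set.subset_union_left.trans Set.subset_union_right)
    · exact (ihb h).trans (Set.subset_union_right.trans Set.subset_union_right)

theorem finite_sub (Φ : LTL m) : (sub Φ).Finite := by
  induction Φ with
  | tt | atom => exact Set.finite_singleton _
  | neg a iha => exact (Set.finite_singleton _).union iha
  | and a b iha ihb | untl a b iha ihb | snce a b iha ihb =>
    exact (Set.finite_singleton _).union (iha.union ihb)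

end LTL

/-! ## Two-way alternating automata and their determinisation -/

/-- Positive Boolean formulas over `α`. -/
inductive PosBool (α : Type*) where
  | tt : PosBool α
  | ff : PosBool α
  | atom (a : α) : PosBool α
  | and (f g : PosBool α) : PosBool α
  | or (f g : PosBool α) : PosBool α

namespace PosBool

/-- The set `X` satisfies the positive Boolean formula. -/
def Sat {α : Type*} (X : Set α) : PosBool α → Prop
  | tt => True
  | ff => False
  | atom a => a ∈ X
  | and f g => Sat X f ∧ Sat X g
  | or f g => Sat X f ∨ Sat X g

/-- The atoms of the formula. -/
def atoms {α : Type*} : PosBool α → Set α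
  | tt => ∅
  | ff => ∅
  | atom a => {a}
  | and f g => atoms f ∪ atoms g
  | or f g => atoms f ∪ atoms g

/-- Regard a formula whose atoms use only states in `C` as a formula over the state space `C`. -/
def codRestrict {S D : Type*} (C : Set S) :
    (f : PosBool (S × D)) → (∀ x ∈ f.atoms, x.1 ∈ C) → PosBool (C × D)
  | tt, _ => tt
  | ff, _ => ff
  | atom a, h => atom (⟨a.1, h a rfl⟩, a.2)
  | and f g, h => and (codRestrict C f fun x hx => h x (Or.inl hx))
      (codRestrict C g fun x hx => h x (Or.inr hx))
  | or f g, h => or (codRestrict C f fun x hx => h x (Or.inl hx))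
      (codRestrict C g fun x hx => h x (Or.inr hx))

end PosBool

/-- The directions in which the head of a two-way automaton can move. -/
inductive Dir where
  | left
  | stay
  | right

/-- Two-way alternating automata over the alphabet `Γ` with states `S`. The input tape consists
of a left end-marker (on which the automaton reads `none`) followed by the letters of the word;
the automaton starts on the first letter in state `init`. -/
structure TwoWayAlt (Γ S : Type*) where
  init : S
  δ : S → Option Γ → PosBool (S × Dir)
  acc : Set S

namespace TwoWayAlt

variable {Γ S : Type*}

/-- The same automaton with the empty set of accepting states. -/
def emptied (A : TwoWayAlt Γ S) : TwoWayAlt Γ S := { A with acc := ∅ }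

/-- The states from which the automaton, regarded as an automaton over finite words, has an
accepting run when started on the cell with content `a`; here `X` is the set of states from which
it has one on the cell to the right, and `L Y` the set of those on the cell to the left if `Y` is
the set of those on the present cell. As all branches of a run on a finite word have to be finite,
this is a least fixed point. -/
def cross (A : TwoWayAlt Γ S) (L : Set S → Set S) (a : Option Γ) (X : Set S) : Set S :=
  ⋂₀ {Y | ∀ q, (A.δ q a).Sat {x | match x.2 with
    | Dir.left => x.1 ∈ L Y
    | Dir.stay => x.1 ∈ Y
    | Dir.right => x.1 ∈ X} → q ∈ Y}

/-- The deterministic automaton equivalent, over finite words, to the two-way alternating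
automaton `A`. After it has read a word `w`, its state consists of two maps. Applied to a set `X`
of states assumed to be accepting on the cell just after `w`, the first map gives the set of states
from which `A` accepts on the last cell of the tape with content `w` (the end-marker if `w` is
empty), the second one the set of states from which `A` accepts on the first cell after the
end-marker. Accordingly `w` is accepted if the initial state lies in the value of the second map at
the set of accepting states. -/
def toDFA (A : TwoWayAlt Γ S) : DFA Γ ((Set S → Set S) × (Set S → Set S)) where
  step s a := (A.cross s.1 (some a), fun X => s.2 (A.cross s.1 (some a) X))
  start := (A.cross (fun _ => ∅) none, id)
  accept := {s | A.init ∈ s.2 A.acc}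

end TwoWayAlt

/-! ## The automata for an LTL formula -/

/-- States of the two-way alternating automaton for an LTL formula: `now true Ψ` (`now false Ψ`)
checks that `Ψ` holds (fails) at the present position, and `back true Ψ₁ Ψ₂` (`back false Ψ₁ Ψ₂`)
checks that the non-strict version of `Ψ₁` since `Ψ₂` holds (fails) there. -/
inductive Obl (m : ℕ) where
  | now (b : Bool) (Ψ : LTL m) : Obl m
  | back (b : Bool) (Ψ₁ Ψ₂ : LTL m) : Obl m

namespace LTL

variable {m : ℕ}

open Classical in
/-- The transition function. -/
noncomputable def transition : Obl m → Option (Set (Fin m)) → PosBool (Obl m × Dir)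
  | .now true tt, some _ => .tt
  | .now false tt, some _ => .ff
  | .now true (atom q), some a => if q ∈ a then .tt else .ff
  | .now false (atom q), some a => if q ∈ a then .ff else .tt
  | .now true (and x y), some _ =>
      .and (.atom (.now true x, .stay)) (.atom (.now true y, .stay))
  | .now false (and x y), some _ =>
      .or (.atom (.now false x, .stay)) (.atom (.now false y, .stay))
  | .now b (neg x), some _ => .atom (.now (!b) x, .stay)
  | .now true (untl x y), some _ =>
      .or (.atom (.now true y, .right))
        (.and (.atom (.now true x, .right)) (.atom (.now true (untl x y), .right)))
  | .now false (untl x y), some _ =>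
      .and (.atom (.now false y, .right))
        (.or (.atom (.now false x, .right)) (.atom (.now false (untl x y), .right)))
  | .now b (snce x y), some _ => .atom (.back b x y, .left)
  | .back true x y, some _ =>
      .or (.atom (.now true y, .stay))
        (.and (.atom (.now true x, .stay)) (.atom (.back true x y, .left)))
  | .back false x y, some _ =>
      .and (.atom (.now false y, .stay))
        (.or (.atom (.now false x, .stay)) (.atom (.back false x y, .left)))
  | .back true _ _, none => .ff
  | .back false _ _, none => .tt
  | .now _ _, none => .ff

/-- The states used by the automaton for `Φ`: those built from subformulas of `Φ`. -/
def states (Φ : LTL m) : Set (Obl m) :=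
  {o | match o with
    | .now _ Ψ => Ψ ∈ sub Φ
    | .back _ Ψ₁ Ψ₂ => snce Ψ₁ Ψ₂ ∈ sub Φ}

theorem transition_atoms (Φ : LTL m) (o : Obl m) (ho : o ∈ states Φ) (a : Option (Set (Fin m))) :
    ∀ x ∈ (transition o a).atoms, x.1 ∈ states Φ := by
  intro x hx
  have key : ∀ {Ψ Ψ' : LTL m}, Ψ ∈ sub Φ → Ψ' ∈ sub Ψ → Ψ' ∈ sub Φ := fun h h' => sub_trans h h'
  rcases a with _ | a
  · rcases o with ⟨b, Ψ⟩ | ⟨b, y, z⟩ <;> cases b <;> simp [transition, PosBool.atoms] at hx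
  · rcases o with ⟨b, Ψ⟩ | ⟨b, y, z⟩
    · change Ψ ∈ sub Φ at ho
      cases Ψ <;> cases b <;> simp only [transition, PosBool.atoms] at hx <;>
        (try split_ifs at hx) <;>
        simp only [PosBool.atoms, Set.mem_union, Set.mem_singleton_iff, Set.mem_empty_iff_false]
          at hx <;>
        (try rcases hx with rfl | rfl | rfl) <;>
        first
        | exact ho
        | exact key ho (by simp [sub, mem_sub_self])
    · change snce y z ∈ sub Φ at ho
      cases b <;> simp only [transition, PosBool.atoms, Set.mem_union, Set.mem_singleton_iff] at hx <;>
        rcases hx with rfl | rfl | rfl <;>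
        first
        | exact ho
        | exact key ho (by simp [sub, mem_sub_self])

/-- The two-way alternating Büchi automaton for `Φ`; the accepting states are the negated untils,
the only states in which a run on an infinite word may stay forever. -/
noncomputable def automaton (Φ : LTL m) : TwoWayAlt (Set (Fin m)) (states Φ) where
  init := ⟨.now true Φ, mem_sub_self Φ⟩
  δ o a := (transition o.1 a).codRestrict (states Φ) (transition_atoms Φ o.1 o.2 a)
  acc := {o | ∃ x y : LTL m, o.1 = .now false (untl x y)}

instance (Φ : LTL m) : Finite (states Φ) := by
  have h : (states Φ) ⊆ (fun x : Bool × LTL m => Obl.now x.1 x.2) '' (Set.univ ×ˢ sub Φ) ∪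
      (fun x : Bool × LTL m × LTL m => Obl.back x.1 x.2.1 x.2.2) ''
        (Set.univ ×ˢ (sub Φ ×ˢ sub Φ)) := by
    rintro (⟨b, Ψ⟩ | ⟨b, y, z⟩) ho
    · exact Or.inl ⟨(b, Ψ), ⟨trivial, ho⟩, rfl⟩
    · have ho : snce y z ∈ sub Φ := ho
      exact Or.inr ⟨(b, y, z), ⟨trivial, sub_trans ho (by simp [sub, mem_sub_self]),
        sub_trans ho (by simp [sub, mem_sub_self])⟩, rfl⟩
  refine (Set.Finite.subset ?_ h).to_subtype
  exact ((Set.finite_univ.prod (finite_sub Φ)).image _).union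
    ((Set.finite_univ.prod ((finite_sub Φ).prod (finite_sub Φ))).image _)

/-- The states of the deterministic automata. -/
abbrev DState (Φ : LTL m) : Type :=
  (Set (states Φ) → Set (states Φ)) × (Set (states Φ) → Set (states Φ))

theorem finite_DState (Φ : LTL m) : Finite (DState Φ) := inferInstance

/-- The automaton `𝒟_good`. -/
noncomputable def Dgood (Φ : LTL m) : DFA (Set (Fin m)) (DState Φ) :=
  (automaton Φ).emptied.toDFA

/-- The automaton `𝒟_bad`. -/
noncomputable def Dbad (Φ : LTL m) : DFA (Set (Fin m)) (DState (neg Φ)) :=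
  (automaton (neg Φ)).emptied.toDFA

end LTL

/-! ## The monitor -/

section Monitor

variable {P : Type*} {m : ℕ}

/-- `l_fr`: the number of events after the current one kept in the sliding window. -/
def lfr (ψ : Fin m → MTL P) (kvar : ℕ) : ℕ :=
  Finset.univ.sup fun i => kvar * ⌈(ψ i).fr⌉₊

/-- `l_pr`: the number of events before the current one kept in the sliding window. -/
def lpr (ψ : Fin m → MTL P) (kvar : ℕ) : ℕ :=
  Finset.univ.sup fun i => kvar * ⌈(ψ i).pr⌉₊

/-- The letter computed by the monitor for position `j` of the trace `ρ`: the set of those `i` for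
which the trace-checking of `ψ_i` at position `j` succeeds on the sliding window, which consists of
the events at positions `j - l_pr` (or `0`, if this is negative), …, `j + l_fr`. -/
def monitorLetter (ψ : Fin m → MTL P) (kvar : ℕ) (ρ : InfTimedWord P) (j : ℕ) : Set (Fin m) :=
  {i | (ρ.window (j - lpr ψ kvar) (j - (j - lpr ψ kvar) + lfr ψ kvar)).Sat
    ⟨j - (j - lpr ψ kvar), Nat.lt_succ_of_le (Nat.le_add_right _ _)⟩ (ψ i)}

/-- The word consisting of the first `l` letters that the monitor feeds into its automata. -/
def monitorWord (ψ : Fin m → MTL P) (kvar : ℕ) (ρ : InfTimedWord P) (l : ℕ) :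
    List (Set (Fin m)) :=
  (List.range l).map (monitorLetter ψ kvar ρ)

end Monitor

/-!
The proof has three ingredients.

*Locality.* The truth value of a bounded formula `φ` at a position `i` depends only on the events
at a time distance of at most `fr φ` after and at most `pr φ` before `i` (`MTL.pSat_comp_iff`). If
the variability is at most `k`, then two positions that are more than `k * n` apart are separated
by more than `n` units of time (`InfTimedWord.VariabilityAtMost.add_lt`), so the monitor's window
contains all relevant events. This gives the first claim.

*Truncated semantics.* On a finite word that extends at least `fr φ` units of time beyond `i`, the
additional disjuncts of the weak view are false, hence the strong, the weak and the neutral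
relations agree on `φ` at `i` (`FinTimedWord.tSat_iff_sat`). So on every long enough prefix of the
input the letters `u₀, …, u_{l-1}` are the truth values of the `ψ i` in both views.

*Automata.* Fix such a prefix and let `Obl.cell t` be the set of automaton states whose
intended meaning is true at the `t`-th tape cell, where `now true Ψ` means that `Ψ` holds strongly
and `now false Ψ` that it does not even hold weakly. One transition preserves truth
(`Obl.mem_cell_of_transition`): a state whose transition formula is satisfied by true states is
itself true. The acceptance sets of a two-way automaton on finite words are least fixed points, so
they are contained in the sets of true states (`TwoWayAlt.eval_toDFA_subset`), whatever lies
beyond the word, since nothing is assumed to be accepted there. Acceptance by `𝒟_good` thus yields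
strong satisfaction of `Φ(ψ₁, …, ψ_m)`, and acceptance by `𝒟_bad` that of its negation.
-/

/-! ### Time intervals -/

namespace TimeInterval

theorem lo_le_of_mem {I : TimeInterval} {x : ℝ} (h : x ∈ I.toSet) : (I.lo : ℝ) ≤ x := by
  have h1 := h.1
  split_ifs at h1
  · exact h1
  · exact h1.le

theorem IsBounded.hi_eq {I : TimeInterval} (hI : I.IsBounded) : I.hi = (I.sup : WithTop NNRat) :=
  by
  obtain ⟨b, hb⟩ := WithTop.ne_top_iff_exists.1 hI
  simp [sup, ← hb]

theorem IsBounded.le_sup_of_mem {I : TimeInterval} (hI : I.IsBounded) {x : ℝ} (h : x ∈ I.toSet) :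
    x ≤ (I.sup : ℝ) := by
  have h2 := h.2 _ hI.hi_eq
  split_ifs at h2
  · exact h2
  · exact h2.le

theorem mem_univ_toSet {x : ℝ} : x ∈ univ.toSet ↔ 0 < x := by
  simp [toSet, univ]

theorem ltSup_univ (x : ℝ) : univ.LtSup x := by
  intro b hb
  simp [univ] at hb

end TimeInterval

/-- Truncated subtraction of non-negative rationals is at least the subtraction of reals. -/
theorem NNRat.sub_le_cast_tsub (a b : NNRat) : (a : ℝ) - b ≤ ((a - b : NNRat) : ℝ) := by
  have h : (a : ℝ) ≤ ((a - b + b : NNRat) : ℝ) := by exact_mod_cast le_tsub_add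
  push_cast at h
  linarith

theorem NNRat.cast_le_of_max_le {a b : NNRat} {x : ℝ} (h : ((max a b : NNRat) : ℝ) ≤ x) :
    (a : ℝ) ≤ x ∧ (b : ℝ) ≤ x :=
  ⟨le_trans (by exact_mod_cast le_max_left a b) h, le_trans (by exact_mod_cast le_max_right a b) h⟩

/-! ### Locality of bounded formulas -/

namespace MTL

variable {P : Type*}

/-- The events of a sequence over `Y` that `φ` can depend on at the position `p` are among those at
the positions in `S`. -/
def ReachIn {Y : Type*} [LinearOrder Y] (τ : Y → ℝ) (S : Set Y) (φ : MTL P) (p : Y) : Prop :=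
  (∀ q, p ≤ q → τ q - τ p ≤ φ.fr → q ∈ S) ∧ ∀ q, q ≤ p → τ p - τ q ≤ φ.pr → q ∈ S

section Reach

variable {Y : Type*} [LinearOrder Y] {τ : Y → ℝ} {S : Set Y}

/-- Moving the point of evaluation from `p` to a position `q` of `S` after `p` by a time in
`[a, b]` is possible if the future-reach at `p` is larger by `b`, while the past-reach at `p` may
be smaller by `a`. -/
theorem ReachIn.of_le (hS : S.OrdConnected) {φ ψ : MTL P} {p q : Y} (hpS : p ∈ S) (hq : q ∈ S)
    (h : ReachIn τ S φ p) (hpq : p ≤ q) {a b : ℝ} (ha : a ≤ τ q - τ p) (hb : τ q - τ p ≤ b)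
    (hf : ψ.fr + b ≤ (φ.fr : ℝ)) (hp : (ψ.pr : ℝ) - a ≤ φ.pr) : ReachIn τ S ψ q := by
  refine ⟨fun r hr h' => h.1 r (hpq.trans hr) (by linarith), fun r hr h' => ?_⟩
  rcases le_total r p with hrp | hrp
  · exact h.2 r hrp (by linarith)
  · exact hS.out hpS hq ⟨hrp, hr⟩

theorem ReachIn.of_ge (hS : S.OrdConnected) {φ ψ : MTL P} {p q : Y} (hpS : p ∈ S) (hq : q ∈ S)
    (h : ReachIn τ S φ p) (hpq : q ≤ p) {a b : ℝ} (ha : a ≤ τ p - τ q) (hb : τ p - τ q ≤ b)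
    (hf : ψ.pr + b ≤ (φ.pr : ℝ)) (hp : (ψ.fr : ℝ) - a ≤ φ.fr) : ReachIn τ S ψ q := by
  refine ⟨fun r hr h' => ?_, fun r hr h' => h.2 r (hr.trans hpq) (by linarith)⟩
  rcases le_total p r with hrp | hrp
  · exact h.1 r hrp (by linarith)
  · exact hS.out hq hpS ⟨hr, hrp⟩

end Reach

/-- Restricting a sequence of events to a convex set of positions (the range of `f`) does not
change the truth value of a bounded formula at a position whose reach stays in this set. -/
theorem pSat_comp_iff {X Y : Type*} [LinearOrder X] [LinearOrder Y] {σ : X → Set P} {τ : X → ℝ}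
    {σ' : Y → Set P} {τ' : Y → ℝ} (hτ' : Monotone τ') {f : X → Y} (hf : StrictMono f)
    (hconn : (Set.range f).OrdConnected) (hσ : ∀ a, σ a = σ' (f a))
    (hτ : ∀ a b, τ a - τ b = τ' (f a) - τ' (f b)) (φ : MTL P) (hφ : φ.Bounded) (i : X)
    (h : φ.ReachIn τ' (Set.range f) (f i)) : φ.PSat σ τ i ↔ φ.PSat σ' τ' (f i) := by
  have mem : ∀ a, f a ∈ Set.range f := fun a => ⟨a, rfl⟩
  have mono : ∀ {a b}, f a < f b → τ' (f a) ≤ τ' (f b) := fun hab => hτ' hab.le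
  induction φ generalizing i with
  | tt => exact Iff.rfl
  | atom p => simp only [PSat, hσ]
  | neg φ ih => exact not_congr (ih hφ i h)
  | and φ₁ φ₂ ih₁ ih₂ =>
    have e1 : φ₁.ReachIn τ' (Set.range f) (f i) := by
      refine ReachIn.of_le (a := 0) (b := 0) hconn (mem i) (mem i) h le_rfl (by simp) (by simp)
        ?_ ?_ <;> simp [fr, pr]
    have e2 : φ₂.ReachIn τ' (Set.range f) (f i) := by
      refine ReachIn.of_le (a := 0) (b := 0) hconn (mem i) (mem i) h le_rfl (by simp) (by simp)
        ?_ ?_ <;> simp [fr, pr]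
    exact and_congr (ih₁ hφ.1 i e1) (ih₂ hφ.2 i e2)
  | untl I φ₁ φ₂ ih₁ ih₂ =>
    obtain ⟨hI, hb₁, hb₂⟩ := hφ
    have hfr := NNRat.cast_le_of_max_le (le_refl ((max φ₁.fr φ₂.fr : NNRat) : ℝ))
    have hpr := NNRat.cast_le_of_max_le (le_refl ((max φ₁.pr (φ₂.pr - I.lo) : NNRat) : ℝ))
    have hsub := NNRat.sub_le_cast_tsub φ₂.pr I.lo
    have e2 : ∀ j, f i < f j → τ' (f j) - τ' (f i) ∈ I.toSet →
        (φ₂.PSat σ τ j ↔ φ₂.PSat σ' τ' (f j)) := fun j hij hj => by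
      refine ih₂ hb₂ j (h.of_le hconn (mem i) (mem j) hij.le (I.lo_le_of_mem hj)
        (hI.le_sup_of_mem hj) ?_ ?_) <;> simp only [fr, pr, NNRat.cast_add] <;> linarith
    have e1 : ∀ j k, τ' (f j) - τ' (f i) ∈ I.toSet → f i < f k → f k < f j →
        (φ₁.PSat σ τ k ↔ φ₁.PSat σ' τ' (f k)) := fun j k hj hik hkj => by
      have := mono hik
      have := mono hkj
      have := hI.le_sup_of_mem hj
      refine ih₁ hb₁ k (h.of_le (a := 0) (b := I.sup) hconn (mem i) (mem k) hik.le (by linarith)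
        (by linarith) ?_ ?_) <;> simp only [fr, pr, NNRat.cast_add] <;> linarith
    simp only [PSat, hτ]
    constructor
    · rintro ⟨j, hij, h2, hj, h1⟩
      refine ⟨f j, hf hij, (e2 j (hf hij) hj).1 h2, hj, fun k hik hkj => ?_⟩
      obtain ⟨k, rfl⟩ := hconn.out (mem i) (mem j) ⟨hik.le, hkj.le⟩
      exact (e1 j k hj hik hkj).1 (h1 k (hf.lt_iff_lt.1 hik) (hf.lt_iff_lt.1 hkj))
    · rintro ⟨j, hij, h2, hj, h1⟩
      obtain ⟨j, rfl⟩ : j ∈ Set.range f := h.1 j hij.le <| by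
        have := hI.le_sup_of_mem hj
        have : (0 : ℝ) ≤ φ₁.fr := NNRat.cast_nonneg _
        simp only [fr, NNRat.cast_add]
        linarith
      exact ⟨j, hf.lt_iff_lt.1 hij, (e2 j hij hj).2 h2, hj, fun k hik hkj =>
        (e1 j k hj (hf hik) (hf hkj)).2 (h1 _ (hf hik) (hf hkj))⟩
  | snce I φ₁ φ₂ ih₁ ih₂ =>
    obtain ⟨hI, hb₁, hb₂⟩ := hφ
    have hpr := NNRat.cast_le_of_max_le (le_refl ((max φ₁.pr φ₂.pr : NNRat) : ℝ))
    have hfr := NNRat.cast_le_of_max_le (le_refl ((max φ₁.fr (φ₂.fr - I.lo) : NNRat) : ℝ))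
    have hsub := NNRat.sub_le_cast_tsub φ₂.fr I.lo
    have e2 : ∀ j, f j < f i → τ' (f i) - τ' (f j) ∈ I.toSet →
        (φ₂.PSat σ τ j ↔ φ₂.PSat σ' τ' (f j)) := fun j hij hj => by
      refine ih₂ hb₂ j (h.of_ge hconn (mem i) (mem j) hij.le (I.lo_le_of_mem hj)
        (hI.le_sup_of_mem hj) ?_ ?_) <;> simp only [fr, pr, NNRat.cast_add] <;> linarith
    have e1 : ∀ j k, τ' (f i) - τ' (f j) ∈ I.toSet → f k < f i → f j < f k →
        (φ₁.PSat σ τ k ↔ φ₁.PSat σ' τ' (f k)) := fun j k hj hik hkj => by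
      have := mono hik
      have := mono hkj
      have := hI.le_sup_of_mem hj
      refine ih₁ hb₁ k (h.of_ge (a := 0) (b := I.sup) hconn (mem i) (mem k) hik.le (by linarith)
        (by linarith) ?_ ?_) <;> simp only [fr, pr, NNRat.cast_add] <;> linarith
    simp only [PSat, hτ]
    constructor
    · rintro ⟨j, hij, h2, hj, h1⟩
      refine ⟨f j, hf hij, (e2 j (hf hij) hj).1 h2, hj, fun k hkj hik => ?_⟩
      obtain ⟨k, rfl⟩ := hconn.out (mem j) (mem i) ⟨hkj.le, hik.le⟩
      exact (e1 j k hj hik hkj).1 (h1 k (hf.lt_iff_lt.1 hkj) (hf.lt_iff_lt.1 hik))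
    · rintro ⟨j, hij, h2, hj, h1⟩
      obtain ⟨j, rfl⟩ : j ∈ Set.range f := h.2 j hij.le <| by
        have := hI.le_sup_of_mem hj
        have : (0 : ℝ) ≤ φ₁.pr := NNRat.cast_nonneg _
        simp only [pr, NNRat.cast_add]
        linarith
      exact ⟨j, hf.lt_iff_lt.1 hij, (e2 j hij hj).2 h2, hj, fun k hkj hik =>
        (e1 j k hj (hf hik) (hf hkj)).2 (h1 _ (hf hkj) (hf hik))⟩
  | guntl I c hc φ₁ φ₂ ih₁ ih₂ =>
    obtain ⟨hI, hb₁, hb₂⟩ := hφ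
    have hfr := NNRat.cast_le_of_max_le
      (le_refl ((max (c + (I.sup - I.lo) + φ₁.fr) (I.sup + φ₂.fr) : NNRat) : ℝ))
    have hpr := NNRat.cast_le_of_max_le (le_refl ((max (φ₁.pr - c) (φ₂.pr - I.lo) : NNRat) : ℝ))
    have hsub := NNRat.sub_le_cast_tsub φ₂.pr I.lo
    have hsub₁ := NNRat.sub_le_cast_tsub φ₁.pr c
    have hsub₂ := NNRat.sub_le_cast_tsub I.sup I.lo
    simp only [NNRat.cast_add] at hfr
    have e2 : ∀ j, f i < f j → τ' (f j) - τ' (f i) ∈ I.toSet →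
        (φ₂.PSat σ τ j ↔ φ₂.PSat σ' τ' (f j)) := fun j hij hj => by
      refine ih₂ hb₂ j (h.of_le hconn (mem i) (mem j) hij.le (I.lo_le_of_mem hj)
        (hI.le_sup_of_mem hj) ?_ ?_) <;> simp only [fr, pr] <;> linarith
    have e1 : ∀ j k, τ' (f j) - τ' (f i) ∈ I.toSet → f i < f k →
        (c : ℝ) < τ' (f k) - τ' (f i) → (I.lo : ℝ) - c < τ' (f j) - τ' (f k) →
        (φ₁.PSat σ τ k ↔ φ₁.PSat σ' τ' (f k)) := fun j k hj hik hck hkj => by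
      have := hI.le_sup_of_mem hj
      refine ih₁ hb₁ k (h.of_le (a := c) (b := c + I.sup - I.lo) hconn (mem i) (mem k) hik.le
        (by linarith) (by linarith) ?_ ?_) <;> simp only [fr, pr] <;> linarith
    simp only [PSat, hτ]
    constructor
    · rintro ⟨j, hij, h2, hj, h1⟩
      refine ⟨f j, hf hij, (e2 j (hf hij) hj).1 h2, hj, fun k hik hkj hc₁ hc₂ => ?_⟩
      obtain ⟨k, rfl⟩ := hconn.out (mem i) (mem j) ⟨hik.le, hkj.le⟩
      exact (e1 j k hj hik hc₁ hc₂).1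
        (h1 k (hf.lt_iff_lt.1 hik) (hf.lt_iff_lt.1 hkj) hc₁ hc₂)
    · rintro ⟨j, hij, h2, hj, h1⟩
      obtain ⟨j, rfl⟩ : j ∈ Set.range f := h.1 j hij.le <| by
        have := hI.le_sup_of_mem hj
        have : (0 : ℝ) ≤ φ₂.fr := NNRat.cast_nonneg _
        simp only [fr]
        linarith
      exact ⟨j, hf.lt_iff_lt.1 hij, (e2 j hij hj).2 h2, hj, fun k hik hkj hc₁ hc₂ =>
        (e1 j k hj (hf hik) hc₁ hc₂).2 (h1 _ (hf hik) (hf hkj) hc₁ hc₂)⟩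
  | gsnce I c hc φ₁ φ₂ ih₁ ih₂ =>
    obtain ⟨hI, hb₁, hb₂⟩ := hφ
    have hpr := NNRat.cast_le_of_max_le
      (le_refl ((max (c + (I.sup - I.lo) + φ₁.pr) (I.sup + φ₂.pr) : NNRat) : ℝ))
    have hfr := NNRat.cast_le_of_max_le (le_refl ((max (φ₁.fr - c) (φ₂.fr - I.lo) : NNRat) : ℝ))
    have hsub := NNRat.sub_le_cast_tsub φ₂.fr I.lo
    have hsub₁ := NNRat.sub_le_cast_tsub φ₁.fr c
    have hsub₂ := NNRat.sub_le_cast_tsub I.sup I.lo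
    simp only [NNRat.cast_add] at hpr
    have e2 : ∀ j, f j < f i → τ' (f i) - τ' (f j) ∈ I.toSet →
        (φ₂.PSat σ τ j ↔ φ₂.PSat σ' τ' (f j)) := fun j hij hj => by
      refine ih₂ hb₂ j (h.of_ge hconn (mem i) (mem j) hij.le (I.lo_le_of_mem hj)
        (hI.le_sup_of_mem hj) ?_ ?_) <;> simp only [fr, pr] <;> linarith
    have e1 : ∀ j k, τ' (f i) - τ' (f j) ∈ I.toSet → f k < f i →
        (c : ℝ) < τ' (f i) - τ' (f k) → (I.lo : ℝ) - c < τ' (f k) - τ' (f j) →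
        (φ₁.PSat σ τ k ↔ φ₁.PSat σ' τ' (f k)) := fun j k hj hik hck hkj => by
      have := hI.le_sup_of_mem hj
      refine ih₁ hb₁ k (h.of_ge (a := c) (b := c + I.sup - I.lo) hconn (mem i) (mem k) hik.le
        (by linarith) (by linarith) ?_ ?_) <;> simp only [fr, pr] <;> linarith
    simp only [PSat, hτ]
    constructor
    · rintro ⟨j, hij, h2, hj, h1⟩
      refine ⟨f j, hf hij, (e2 j (hf hij) hj).1 h2, hj, fun k hkj hik hc₁ hc₂ => ?_⟩
      obtain ⟨k, rfl⟩ := hconn.out (mem j) (mem i) ⟨hkj.le, hik.le⟩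
      exact (e1 j k hj hik hc₁ hc₂).1
        (h1 k (hf.lt_iff_lt.1 hkj) (hf.lt_iff_lt.1 hik) hc₁ hc₂)
    · rintro ⟨j, hij, h2, hj, h1⟩
      obtain ⟨j, rfl⟩ : j ∈ Set.range f := h.2 j hij.le <| by
        have := hI.le_sup_of_mem hj
        have : (0 : ℝ) ≤ φ₂.pr := NNRat.cast_nonneg _
        simp only [pr]
        linarith
      exact ⟨j, hf.lt_iff_lt.1 hij, (e2 j hij hj).2 h2, hj, fun k hkj hik hc₁ hc₂ =>
        (e1 j k hj (hf hik) hc₁ hc₂).2 (h1 _ (hf hkj) (hf hik) hc₁ hc₂)⟩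

end MTL

namespace InfTimedWord

variable {P : Type*}

theorem range_window_index (s l : ℕ) :
    Set.range (fun a : Fin (l + 1) => s + (a : ℕ)) = Set.Icc s (s + l) := by
  ext p
  simp only [Set.mem_range, Set.mem_Icc]
  constructor
  · rintro ⟨a, rfl⟩
    omega
  · rintro ⟨h1, h2⟩
    exact ⟨⟨p - s, by omega⟩, by simp; omega⟩

theorem window_sat_iff (ρ : InfTimedWord P) (s l : ℕ) {φ : MTL P} (hφ : φ.Bounded)
    (i : Fin (l + 1)) (h : φ.ReachIn ρ.τ (Set.Icc s (s + l)) (s + i)) :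
    (ρ.window s l).Sat i φ ↔ ρ.Sat (s + i) φ := by
  refine MTL.pSat_comp_iff (σ := (ρ.window s l).σ) (τ := (ρ.window s l).τ) (σ' := ρ.σ)
    ρ.mono.monotone (f := fun a : Fin (l + 1) => s + (a : ℕ)) (fun a b hab => by simpa using hab)
    ((range_window_index s l).symm ▸ Set.ordConnected_Icc) (fun _ => rfl) (fun a b => ?_) φ hφ i
    ((range_window_index s l).symm ▸ h)
  simp [window]

/-! ### Variability -/

/-- The event at time `0` lies in none of the open intervals to which the bound on the variability
applies, so it is excluded here. -/
theorem VariabilityAtMost.add_one_le {ρ : InfTimedWord P} {k : ℕ} (hρ : ρ.VariabilityAtMost k)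
    {i : ℕ} (hi : 0 < i) : ρ.τ i + 1 ≤ ρ.τ (i + k) := by
  by_contra! hlt
  have hpos : 0 < ρ.τ i := ρ.init.symm.le.trans_lt (ρ.mono hi)
  -- An open unit interval that begins shortly before the event `i` contains `k + 1` events.
  obtain ⟨t, ht, hti⟩ := exists_between (max_lt hpos (sub_left_lt_of_lt_add (by linarith :
    ρ.τ (i + k) < 1 + ρ.τ i)))
  rw [max_lt_iff] at ht
  have hsub : (Finset.Icc i (i + k) : Set ℕ) ⊆ {j | ρ.τ j ∈ Set.Ioo t (t + 1)} := by
    intro j hj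
    rw [Finset.coe_Icc, Set.mem_Icc] at hj
    have h1 := ρ.mono.monotone hj.1
    have h2 := ρ.mono.monotone hj.2
    exact ⟨by linarith, by linarith⟩
  have hcard := (Set.encard_le_encard hsub).trans (hρ t ht.1.le)
  rw [Set.encard_coe_eq_coe_finsetCard, Nat.card_Icc, Nat.cast_le] at hcard
  omega

/-- Events whose positions differ by more than `k * n` are more than `n` units of time apart. -/
theorem VariabilityAtMost.add_lt {ρ : InfTimedWord P} {k : ℕ} (hρ : ρ.VariabilityAtMost k)
    {i j n : ℕ} (hij : i + k * n < j) : ρ.τ i + n < ρ.τ j := by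
  have key : ∀ n : ℕ, ρ.τ (i + 1) + n ≤ ρ.τ (i + 1 + k * n) := by
    intro n
    induction n with
    | zero => simp
    | succ n ih =>
      have := hρ.add_one_le (i := i + 1 + k * n) (by omega)
      rw [Nat.mul_succ, ← add_assoc]
      push_cast
      linarith
  have h1 := ρ.mono (Nat.lt_succ_self i)
  have h2 := ρ.mono.monotone (show i + 1 + k * n ≤ j by omega)
  have := key n
  simp only [Nat.succ_eq_add_one] at h1
  linarith

end InfTimedWord

theorem NNRat.cast_le_natCeil (q : NNRat) : (q : ℝ) ≤ (⌈q⌉₊ : ℝ) := by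
  exact_mod_cast (NNRat.cast_le (K := ℝ)).2 (Nat.le_ceil q)

theorem mem_monitorLetter_iff {P : Type*} {m : ℕ} (ψ : Fin m → MTL P) (hψ : ∀ i, (ψ i).Bounded)
    {k : ℕ} {ρ : InfTimedWord P} (hρ : ρ.VariabilityAtMost k) (j : ℕ) (i : Fin m) :
    i ∈ monitorLetter ψ k ρ j ↔ ρ.Sat j (ψ i) := by
  have hs : j - lpr ψ k + (j - (j - lpr ψ k)) = j := by omega
  have hf : k * ⌈(ψ i).fr⌉₊ ≤ lfr ψ k :=
    Finset.le_sup (f := fun i => k * ⌈(ψ i).fr⌉₊) (Finset.mem_univ i)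
  have hp : k * ⌈(ψ i).pr⌉₊ ≤ lpr ψ k :=
    Finset.le_sup (f := fun i => k * ⌈(ψ i).pr⌉₊) (Finset.mem_univ i)
  refine (ρ.window_sat_iff _ _ (hψ i) _ ?_).trans (by simp only [hs])
  simp only [hs]
  refine ⟨fun q hq hτ => ⟨by omega, ?_⟩, fun q hq hτ => ⟨?_, by omega⟩⟩
  · by_contra! hlt
    have := hρ.add_lt (i := j) (j := q) (n := ⌈(ψ i).fr⌉₊) (by omega)
    have := NNRat.cast_le_natCeil (ψ i).fr
    linarith
  · by_contra! hlt
    have := hρ.add_lt (i := q) (j := j) (n := ⌈(ψ i).pr⌉₊) (by omega)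
    have := NNRat.cast_le_natCeil (ψ i).pr
    linarith

/-! ### The truncated semantics of bounded formulas -/

namespace FinTimedWord

variable {P : Type*}

theorem and_and_congr_of_mid {a a' b c c' : Prop} (ha : b → (a ↔ a')) (hc : b → (c ↔ c')) :
    a ∧ b ∧ c ↔ a' ∧ b ∧ c' := by
  tauto

/-- On a finite word that covers the future-reach of a bounded formula, the strong, the weak and
the neutral relations agree. -/
theorem tSat_iff_sat (ρ : FinTimedWord P) {φ : MTL P} (hφ : φ.Bounded) (v : View)
    (i : Fin (ρ.last + 1)) (h : (φ.fr : ℝ) ≤ ρ.τ (Fin.last _) - ρ.τ i) :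
    ρ.TSat v φ i ↔ ρ.Sat i φ := by
  unfold Sat
  -- The additional disjunct of the weak view needs `τ_last - τ_i < sup I`.
  have noAlt : ∀ {v : View} {I : TimeInterval} {x : ℝ} {p : Prop}, I.IsBounded →
      (I.sup : ℝ) ≤ x → ¬ (v = View.weak ∧ I.LtSup x ∧ p) :=
    fun hI hx hp => (hp.2.1 _ hI.hi_eq).not_ge hx
  induction φ generalizing i v with
  | tt => simp only [TSat, MTL.PSat]
  | atom p => simp only [TSat, MTL.PSat]
  | neg φ ih =>
    simp only [TSat, MTL.PSat]
    exact not_congr (ih hφ _ i h)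
  | and φ₁ φ₂ ih₁ ih₂ =>
    have hm := NNRat.cast_le_of_max_le h
    simp only [TSat, MTL.PSat]
    exact and_congr (ih₁ hφ.1 v i hm.1) (ih₂ hφ.2 v i hm.2)
  | untl I φ₁ φ₂ ih₁ ih₂ =>
    obtain ⟨hI, hb₁, hb₂⟩ := hφ
    have hm := NNRat.cast_le_of_max_le (le_refl ((max φ₁.fr φ₂.fr : NNRat) : ℝ))
    simp only [MTL.fr, NNRat.cast_add] at h
    have : (0 : ℝ) ≤ φ₁.fr := NNRat.cast_nonneg _
    simp only [TSat, MTL.PSat]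
    rw [or_iff_left (noAlt hI (by linarith))]
    refine exists_congr fun j => and_congr_right fun hij => and_and_congr_of_mid (fun hj => ?_)
      fun hj => forall_congr' fun k => forall_congr' fun hik => forall_congr' fun hkj => ?_
    · have := hI.le_sup_of_mem hj
      exact ih₂ hb₂ v j (by linarith)
    · have := hI.le_sup_of_mem hj
      have := ρ.mono hkj
      exact ih₁ hb₁ v k (by linarith)
  | snce I φ₁ φ₂ ih₁ ih₂ =>
    obtain ⟨hI, hb₁, hb₂⟩ := hφ
    have hm := NNRat.cast_le_of_max_le h
    have hsub := NNRat.sub_le_cast_tsub φ₂.fr I.lo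
    simp only [TSat, MTL.PSat]
    refine exists_congr fun j => and_congr_right fun hij => and_and_congr_of_mid (fun hj => ?_)
      fun hj => forall_congr' fun k => forall_congr' fun hjk => forall_congr' fun hki => ?_
    · have := I.lo_le_of_mem hj
      exact ih₂ hb₂ v j (by linarith)
    · have := ρ.mono hki
      exact ih₁ hb₁ v k (by linarith)
  | guntl I c hc φ₁ φ₂ ih₁ ih₂ =>
    obtain ⟨hI, hb₁, hb₂⟩ := hφ
    have hm := NNRat.cast_le_of_max_le h
    simp only [NNRat.cast_add] at hm
    have hsub := NNRat.sub_le_cast_tsub I.sup I.lo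
    have : (0 : ℝ) ≤ φ₂.fr := NNRat.cast_nonneg _
    simp only [TSat, MTL.PSat]
    rw [or_iff_left (noAlt hI (by linarith))]
    refine exists_congr fun j => and_congr_right fun hij => and_and_congr_of_mid (fun hj => ?_)
      fun hj => forall_congr' fun k => forall_congr' fun hik => forall_congr' fun hkj =>
        forall_congr' fun hc₁ => forall_congr' fun hc₂ => ?_
    · have := hI.le_sup_of_mem hj
      exact ih₂ hb₂ v j (by linarith)
    · have := hI.le_sup_of_mem hj
      exact ih₁ hb₁ v k (by linarith)
  | gsnce I c hc φ₁ φ₂ ih₁ ih₂ =>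
    obtain ⟨hI, hb₁, hb₂⟩ := hφ
    have hm := NNRat.cast_le_of_max_le h
    have hsub₁ := NNRat.sub_le_cast_tsub φ₁.fr c
    have hsub := NNRat.sub_le_cast_tsub φ₂.fr I.lo
    simp only [TSat, MTL.PSat]
    refine exists_congr fun j => and_congr_right fun hij => and_and_congr_of_mid (fun hj => ?_)
      fun hj => forall_congr' fun k => forall_congr' fun hjk => forall_congr' fun hki =>
        forall_congr' fun hc₁ => forall_congr' fun hc₂ => ?_
    · have := I.lo_le_of_mem hj
      exact ih₂ hb₂ v j (by linarith)
    · exact ih₁ hb₁ v k (by linarith)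

end FinTimedWord

/-- On a prefix of an infinite word that covers the future-reach of a bounded formula, both views
give the truth value of the formula on the infinite word. -/
theorem InfTimedWord.pre_tSat_iff {P : Type*} (ρ : InfTimedWord P) {φ : MTL P} (hφ : φ.Bounded)
    (v : View) {n : ℕ} (i : Fin (n + 1)) (h : (φ.fr : ℝ) < ρ.τ n - ρ.τ i) :
    (ρ.pre n).TSat v φ i ↔ ρ.Sat i φ := by
  refine ((ρ.pre n).tSat_iff_sat hφ v i (by simpa [pre] using h.le)).trans ?_
  have hrange : Set.range (Fin.val : Fin (n + 1) → ℕ) = Set.Iio (n + 1) := Fin.range_val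
  refine MTL.pSat_comp_iff (σ := (ρ.pre n).σ) (τ := (ρ.pre n).τ) (σ' := ρ.σ) ρ.mono.monotone
    (f := (Fin.val : Fin (n + 1) → ℕ)) Fin.val_strictMono (hrange.symm ▸ Set.ordConnected_Iio)
    (fun _ => rfl) (fun _ _ => rfl) φ hφ i (hrange.symm ▸ ⟨fun q _ hτ => ?_, fun q hq _ => ?_⟩)
  · exact (ρ.mono.lt_iff_lt.1 (by linarith : ρ.τ q < ρ.τ n)).trans n.lt_succ_self
  · exact hq.trans_lt i.is_lt

/-! ### Two-way alternating automata on finite words -/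

namespace PosBool

theorem Sat.mono {α : Type*} {X Y : Set α} (hXY : X ⊆ Y) {f : PosBool α} (h : f.Sat X) :
    f.Sat Y := by
  induction f with
  | tt => trivial
  | ff => exact h
  | atom a => exact hXY h
  | and f g ihf ihg => exact ⟨ihf h.1, ihg h.2⟩
  | or f g ihf ihg => exact h.imp ihf ihg

theorem Sat.of_codRestrict {S D : Type*} {C : Set S} {X : Set (C × D)} {Y : Set (S × D)}
    (hXY : ∀ x ∈ X, ((x.1 : S), x.2) ∈ Y) {f : PosBool (S × D)} {hf : ∀ x ∈ f.atoms, x.1 ∈ C}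
    (h : (f.codRestrict C hf).Sat X) : f.Sat Y := by
  induction f with
  | tt => trivial
  | ff => exact h
  | atom a => exact hXY _ h
  | and f g ihf ihg => exact ⟨ihf h.1, ihg h.2⟩
  | or f g ihf ihg => exact h.imp ihf ihg

end PosBool

namespace TwoWayAlt

variable {Γ S : Type*}

/-- The pairs of a state and a direction such that the state belongs to `L`, `C` or `R` if the
direction leads to the left, nowhere, or to the right, respectively. -/
def moves (L C R : Set S) : Set (S × Dir) :=
  {x | match x.2 with
    | Dir.left => x.1 ∈ L
    | Dir.stay => x.1 ∈ C
    | Dir.right => x.1 ∈ R}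

theorem moves_mono {L L' C R R' : Set S} (hL : L ⊆ L') (hR : R ⊆ R') :
    moves L C R ⊆ moves L' C R' := by
  rintro ⟨q, d⟩ h
  cases d
  · exact hL h
  · exact h
  · exact hR h

/-- A set closed under the transitions on a cell contains the least fixed point `cross`. -/
theorem cross_subset {A : TwoWayAlt Γ S} {L : Set S → Set S} {a : Option Γ} {X C : Set S}
    (h : ∀ q, (A.δ q a).Sat (moves (L C) C X) → q ∈ C) : A.cross L a X ⊆ C :=
  Set.sInter_subset_of_mem h

/-- Let `G t` be a set of states for the `t`-th cell of the tape with content `w`, where the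
end-marker is the cell `0`, such that every transition of `A` leads to a state in these sets only
from states in these sets. Then the maps computed by `A.toDFA` on `w` respect them. -/
theorem eval_toDFA_subset (A : TwoWayAlt Γ S) (G : ℕ → Set S) (w : List Γ)
    (hnone : ∀ q, (A.δ q none).Sat (moves ∅ (G 0) (G 1)) → q ∈ G 0)
    (hsome : ∀ (t : ℕ) (ht : t < w.length) (q : S),
      (A.δ q (some w[t])).Sat (moves (G t) (G (t + 1)) (G (t + 2))) → q ∈ G (t + 1))
    {X : Set S} (hX : X ⊆ G (w.length + 1)) :
    (A.toDFA.eval w).1 X ⊆ G w.length ∧ (A.toDFA.eval w).2 X ⊆ G 1 := by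
  induction w using List.reverseRecOn generalizing X with
  | nil =>
    exact ⟨cross_subset fun q hq => hnone q (hq.mono (moves_mono subset_rfl hX)), hX⟩
  | append_singleton w a ih =>
    have hlen : (w ++ [a]).length = w.length + 1 := by simp
    rw [hlen] at hX
    have ih' := fun {Z : Set S} => @ih (fun t ht q hq => hsome t (by omega) q
      (by rwa [List.getElem_append_left ht])) Z
    have hc : A.cross (A.toDFA.eval w).1 (some a) X ⊆ G (w.length + 1) :=
      cross_subset fun q hq => hsome w.length (by omega) q <| by
        rw [List.getElem_concat_length rfl]
        exact hq.mono (moves_mono (ih' subset_rfl).1 hX)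
    rw [DFA.eval_append_singleton, hlen]
    exact ⟨hc, (ih' hc).2⟩

end TwoWayAlt

/-! ### The automaton of an LTL formula -/

section Automaton

variable {P : Type*} {m : ℕ}

/-- The intended meaning of an automaton state at a position of a finite timed word, with `ψ`
substituted for the propositions. Truth is strong satisfaction, falsity is the failure of weak
satisfaction. -/
def Obl.Holds (ψ : Fin m → MTL P) (ρ : FinTimedWord P) (i : Fin (ρ.last + 1)) : Obl m → Prop
  | .now true Ψ => ρ.TSat .strong (Ψ.subst ψ) i
  | .now false Ψ => ¬ ρ.TSat .weak (Ψ.subst ψ) i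
  | .back true x y => ∃ j ≤ i, ρ.TSat .strong (y.subst ψ) j ∧
      ∀ k, j < k → k ≤ i → ρ.TSat .strong (x.subst ψ) k
  | .back false x y => ¬ ∃ j ≤ i, ρ.TSat .weak (y.subst ψ) j ∧
      ∀ k, j < k → k ≤ i → ρ.TSat .weak (x.subst ψ) k

/-- The states that are true at a tape cell: the cell `0` is the end-marker, where exactly the
negated since-obligations hold, and the cell `t + 1` is the position `t` of the word. -/
def Obl.cell (ψ : Fin m → MTL P) (ρ : FinTimedWord P) : ℕ → Set (Obl m)
  | 0 => {o | ∃ x y, o = .back false x y}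
  | t + 1 => {o | ∃ h : t < ρ.last + 1, o.Holds ψ ρ ⟨t, h⟩}

theorem Obl.mem_cell_of_transition_none {ψ : Fin m → MTL P} {ρ : FinTimedWord P} {o : Obl m}
    {X : Set (Obl m × Dir)} (h : (LTL.transition o none).Sat X) : o ∈ Obl.cell ψ ρ 0 := by
  rcases o with ⟨b, Ψ⟩ | ⟨b, x, y⟩
  · simp [LTL.transition, PosBool.Sat] at h
  · cases b
    · exact ⟨x, y, rfl⟩
    · simp [LTL.transition, PosBool.Sat] at h

/-- Within a word, until with the interval `(0, ∞)` satisfies the usual expansion law. In the weak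
view it holds vacuously at the last position, so the existence of a next position matters. -/
theorem FinTimedWord.tSat_untl_univ_iff (ρ : FinTimedWord P) (v : View) (φ₁ φ₂ : MTL P) {t : ℕ}
    (h : t + 1 < ρ.last + 1) :
    ρ.TSat v (.untl .univ φ₁ φ₂) ⟨t, by omega⟩ ↔ ρ.TSat v φ₂ ⟨t + 1, h⟩ ∨
      (ρ.TSat v φ₁ ⟨t + 1, h⟩ ∧ ρ.TSat v (.untl .univ φ₁ φ₂) ⟨t + 1, h⟩) := by
  have hlt : (⟨t, by omega⟩ : Fin (ρ.last + 1)) < ⟨t + 1, h⟩ := by simp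
  have split : ∀ k : Fin (ρ.last + 1), ⟨t, by omega⟩ < k → k = ⟨t + 1, h⟩ ∨ ⟨t + 1, h⟩ < k := by
    intro k hk
    rw [Fin.lt_def] at hk
    simp only [Fin.ext_iff, Fin.lt_def]
    simp only at hk
    omega
  simp only [FinTimedWord.TSat, TimeInterval.mem_univ_toSet, sub_pos, TimeInterval.ltSup_univ,
    true_and]
  constructor
  · rintro (⟨j, hj, h2, -, h1⟩ | ⟨hv, h1⟩)
    · rcases split j hj with rfl | hj'
      · exact Or.inl h2
      · exact Or.inr ⟨h1 _ hlt hj', Or.inl ⟨j, hj', h2, ρ.mono hj', fun k hk hkj =>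
          h1 k (hlt.trans hk) hkj⟩⟩
    · exact Or.inr ⟨h1 _ hlt, Or.inr ⟨hv, fun k hk => h1 k (hlt.trans hk)⟩⟩
  · rintro (h2 | ⟨h1, ⟨j, hj, h2, -, h3⟩ | ⟨hv, h3⟩⟩)
    · refine Or.inl ⟨_, hlt, h2, ρ.mono hlt, fun k hk hkj => ?_⟩
      rcases split k hk with rfl | hk'
      · exact absurd hkj (lt_irrefl _)
      · exact absurd hkj hk'.asymm
    · refine Or.inl ⟨j, hlt.trans hj, h2, ρ.mono (hlt.trans hj), fun k hk hkj => ?_⟩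
      rcases split k hk with rfl | hk'
      · exact h1
      · exact h3 k hk' hkj
    · refine Or.inr ⟨hv, fun k hk => ?_⟩
      rcases split k hk with rfl | hk'
      · exact h1
      · exact h3 k hk'

theorem FinTimedWord.tSat_snce_univ_iff (ρ : FinTimedWord P) (v : View) (φ₁ φ₂ : MTL P)
    (i : Fin (ρ.last + 1)) :
    ρ.TSat v (.snce .univ φ₁ φ₂) i ↔ ∃ j < i, ρ.TSat v φ₂ j ∧
      ∀ k, j < k → k < i → ρ.TSat v φ₁ k := by
  simp only [FinTimedWord.TSat, TimeInterval.mem_univ_toSet, sub_pos]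
  exact exists_congr fun j => and_congr_right fun hj => and_congr_right fun _ =>
    and_iff_right (ρ.mono hj)

/-- A state whose transition formula is satisfied by true states is true. -/
theorem Obl.mem_cell_of_transition {ψ : Fin m → MTL P} {ρ : FinTimedWord P} {t : ℕ}
    (ht : t < ρ.last + 1) {a : Set (Fin m)}
    (ha : ∀ v q, q ∈ a ↔ ρ.TSat v (ψ q) ⟨t, ht⟩) {o : Obl m}
    (h : (LTL.transition o (some a)).Sat (TwoWayAlt.moves (Obl.cell ψ ρ t)
      (Obl.cell ψ ρ (t + 1)) (Obl.cell ψ ρ (t + 2)))) : o ∈ Obl.cell ψ ρ (t + 1) := by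
  refine ⟨ht, ?_⟩
  rcases o with ⟨b, Ψ⟩ | ⟨b, x, y⟩
  · cases Ψ with
    | tt =>
      cases b
      · exact h.elim
      · simp [Obl.Holds, LTL.subst, FinTimedWord.TSat]
    | atom q =>
      cases b
      · simp only [LTL.transition] at h
        split_ifs at h with hq
        · exact h.elim
        · exact fun h' => hq ((ha .weak q).2 h')
      · simp only [LTL.transition] at h
        split_ifs at h with hq
        · exact (ha .strong q).1 hq
        · exact h.elim
    | and x y =>
      cases b
      · simp only [Obl.Holds, LTL.subst, FinTimedWord.TSat]
        rcases h with ⟨_, h⟩ | ⟨_, h⟩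
        · exact fun h' => h h'.1
        · exact fun h' => h h'.2
      · simp only [Obl.Holds, LTL.subst, FinTimedWord.TSat]
        obtain ⟨⟨_, h₁⟩, ⟨_, h₂⟩⟩ := h
        exact ⟨h₁, h₂⟩
    | neg x =>
      cases b
      · obtain ⟨_, h⟩ := h
        simp only [Obl.Holds, LTL.subst, FinTimedWord.TSat, not_not]
        exact h
      · obtain ⟨_, h⟩ := h
        simp only [Obl.Holds, LTL.subst, FinTimedWord.TSat]
        exact h
    | untl x y =>
      cases b
      · obtain ⟨⟨ht', hy⟩, hx⟩ := h
        simp only [Obl.Holds, LTL.subst]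
        rw [FinTimedWord.tSat_untl_univ_iff _ _ _ _ ht']
        rintro (hy' | ⟨hx', hu'⟩)
        · exact hy hy'
        · rcases hx with ⟨_, hx⟩ | ⟨_, hu⟩
          · exact hx hx'
          · exact hu hu'
      · simp only [Obl.Holds, LTL.subst]
        rcases h with ⟨ht', hy⟩ | ⟨⟨ht', hx⟩, ⟨_, hu⟩⟩
        · exact (FinTimedWord.tSat_untl_univ_iff _ _ _ _ ht').2 (Or.inl hy)
        · exact (FinTimedWord.tSat_untl_univ_iff _ _ _ _ ht').2 (Or.inr ⟨hx, hu⟩)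
    | snce x y =>
      have hlt : ∀ {t : ℕ} (ht : t + 1 < ρ.last + 1) (k : Fin (ρ.last + 1)),
          k < ⟨t + 1, ht⟩ ↔ k ≤ ⟨t, by omega⟩ := fun ht k => by
        simp only [Fin.lt_def, Fin.le_def]
        omega
      cases b
      · simp only [Obl.Holds, LTL.subst, FinTimedWord.tSat_snce_univ_iff]
        cases t with
        | zero =>
          rintro ⟨j, hj, -⟩
          exact absurd hj (Fin.not_lt_zero j)
        | succ t =>
          obtain ⟨_, h⟩ := h
          simpa only [hlt ht, Obl.Holds] using h
      · simp only [Obl.Holds, LTL.subst, FinTimedWord.tSat_snce_univ_iff]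
        cases t with
        | zero =>
          obtain ⟨_, _, h⟩ := h
          simp at h
        | succ t =>
          obtain ⟨_, h⟩ := h
          simpa only [hlt ht, Obl.Holds] using h
  · cases b
    · obtain ⟨⟨_, hy⟩, h⟩ := h
      rintro ⟨j, hj, hj₂, hj₁⟩
      rcases hj.eq_or_lt with rfl | hj'
      · exact hy hj₂
      · rcases h with ⟨_, hx⟩ | h
        · exact hx (hj₁ _ hj' le_rfl)
        · cases t with
          | zero => exact absurd hj' (Fin.not_lt_zero j)
          | succ t =>
            obtain ⟨_, h⟩ := h
            refine h ⟨j, ?_, hj₂, fun k hjk hk => hj₁ k hjk (hk.trans ?_)⟩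
            · rw [Fin.lt_def] at hj'
              exact Fin.le_def.2 (Nat.le_of_lt_succ hj')
            · exact Fin.le_def.2 (Nat.le_succ t)
    · rcases h with ⟨_, hy⟩ | ⟨⟨_, hx⟩, h⟩
      · exact ⟨_, le_rfl, hy, fun k hk hk' => absurd hk hk'.not_gt⟩
      · cases t with
        | zero =>
          obtain ⟨_, _, h⟩ := h
          simp at h
        | succ t =>
          obtain ⟨_, j, hj, hj₂, hj₁⟩ := h
          refine ⟨j, hj.trans (Fin.le_def.2 (Nat.le_succ t)), hj₂, fun k hjk hk => ?_⟩
          rcases hk.eq_or_lt with rfl | hk'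
          · exact hx
          · exact hj₁ k hjk (Fin.le_def.2 (Nat.le_of_lt_succ (Fin.lt_def.1 hk')))

/-- If the automaton for `Φ` with no accepting states accepts a finite word of correct truth
values, then `Φ(ψ₁, …, ψ_m)` holds strongly at the first position. -/
theorem LTL.tSat_strong_of_mem_accept (Φ : LTL m) (ψ : Fin m → MTL P) (ρ : FinTimedWord P)
    (w : List (Set (Fin m))) (hlen : w.length ≤ ρ.last + 1)
    (hw : ∀ (t : ℕ) (ht : t < w.length) (v : View) (q : Fin m),
      q ∈ w[t] ↔ ρ.TSat v (ψ q) ⟨t, by omega⟩)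
    (h : Φ.Dgood.eval w ∈ Φ.Dgood.accept) : ρ.TSat .strong (Φ.subst ψ) 0 := by
  have key := (Φ.automaton.emptied.eval_toDFA_subset
    (fun t => {o : states Φ | (o : Obl m) ∈ Obl.cell ψ ρ t}) w
    (fun q hq => Obl.mem_cell_of_transition_none (ψ := ψ) (ρ := ρ)
      (PosBool.Sat.of_codRestrict (Y := Set.univ) (fun _ _ => trivial) hq))
    (fun t ht q hq => Obl.mem_cell_of_transition (by omega) (hw t ht)
      (PosBool.Sat.of_codRestrict (fun x hx => by
        obtain ⟨q, d⟩ := x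
        cases d <;> exact hx) hq))
    (X := ∅) (Set.empty_subset _)).2
  obtain ⟨_, h'⟩ := key h
  exact h'

end Automaton

/-! ### Soundness of the monitor -/

/-- Eventually, a prefix covers the future-reach of all `ψ i` at all positions below `l`. -/
theorem InfTimedWord.exists_forall_lt_sub {P : Type*} {m : ℕ} (ρ : InfTimedWord P)
    (ψ : Fin m → MTL P) (l : ℕ) :
    ∃ N, l ≤ N ∧ ∀ n ≥ N, ∀ t < l, ∀ i, ((ψ i).fr : ℝ) < ρ.τ n - ρ.τ t := by
  obtain ⟨N, hN⟩ := ρ.unbounded (((Finset.univ.sup fun i => (ψ i).fr : NNRat) : ℝ) + ρ.τ l)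
  refine ⟨max l N, le_max_left _ _, fun n hn t ht i => ?_⟩
  have h1 := ρ.mono.monotone ((le_max_right l N).trans hn)
  have h2 := ρ.mono ht
  have h3 : ((ψ i).fr : ℝ) ≤ ((Finset.univ.sup fun i => (ψ i).fr : NNRat) : ℝ) := by
    exact_mod_cast Finset.le_sup (f := fun i => (ψ i).fr) (Finset.mem_univ i)
  linarith

theorem exists_forall_tSat_strong {P : Type*} {m : ℕ} (Φ : LTL m) (ψ : Fin m → MTL P)
    (hψ : ∀ i, (ψ i).Bounded) {k : ℕ} {ρ : InfTimedWord P} (hρ : ρ.VariabilityAtMost k) {l : ℕ}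
    (h : Φ.Dgood.eval (monitorWord ψ k ρ l) ∈ Φ.Dgood.accept) :
    ∃ N : ℕ, ∀ n ≥ N, (ρ.pre n).TSat .strong (Φ.subst ψ) 0 := by
  obtain ⟨N, hlN, hN⟩ := ρ.exists_forall_lt_sub ψ l
  refine ⟨N, fun n hn => ?_⟩
  have hlen : (monitorWord ψ k ρ l).length = l := by simp [monitorWord]
  have hn' : (ρ.pre n).last = n := rfl
  refine Φ.tSat_strong_of_mem_accept ψ (ρ.pre n) _ (by omega) (fun t ht v q => ?_) h
  have ht' : t < l := by omega
  rw [show (monitorWord ψ k ρ l)[t] = monitorLetter ψ k ρ t by simp [monitorWord],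
    mem_monitorLetter_iff ψ hψ hρ]
  exact (ρ.pre_tSat_iff (hψ q) v (n := n) ⟨t, by omega⟩ (hN n hn t ht' q)).symm

theorem mainTheorem7 {P : Type*} {m : ℕ} (Φ : LTL m) (ψ : Fin m → MTL P)
    (hψ : ∀ i, (ψ i).Bounded) (kvar : ℕ) (ρ : InfTimedWord P) (hρ : ρ.VariabilityAtMost kvar) :
    (∀ (j : ℕ) (i : Fin m), i ∈ monitorLetter ψ kvar ρ j ↔ ρ.Sat j (ψ i)) ∧
    (∀ (l : ℕ), (Φ.Dgood).eval (monitorWord ψ kvar ρ l) ∈ (Φ.Dgood).accept →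
      ∃ N : ℕ, ∀ n ≥ N, (ρ.pre n).InformativeGood (Φ.subst ψ)) ∧
    (∀ (l : ℕ), (Φ.Dbad).eval (monitorWord ψ kvar ρ l) ∈ (Φ.Dbad).accept →
      ∃ N : ℕ, ∀ n ≥ N, (ρ.pre n).InformativeBad (Φ.subst ψ)) := by
  refine ⟨mem_monitorLetter_iff ψ hψ hρ, fun l h => exists_forall_tSat_strong Φ ψ hψ hρ h,
    fun l h => ?_⟩
  -- `𝒟_bad` is `𝒟_good` for the negation, and strong truth of a negation is failure of weak truth.
  obtain ⟨N, hN⟩ := exists_forall_tSat_strong Φ.neg ψ hψ hρ h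
  refine ⟨N, fun n hn => ?_⟩
  have := hN n hn
  rwa [LTL.subst, FinTimedWord.TSat] at this
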